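/- For $n\ge 1$ let $h=\frac{1}{2^n+1}$, let $L_{n,1}=h^{-2}\,\mathrm{tridiag}(1,-2,1)$ be the $2^n\times 2^n$ second-order central-difference Dirichlet Laplacian on $(0,1)$, and let $A_{n,1}=h^2L_{n,1}$ be its normalization. Let $S_n$ be the $2^n\times 2^n$ increment gate, $S_n|j\rangle=|j+1 \bmod 2^n\rangle$, and let $C_n^-$ be the $2^n\times 2^n$ antidiagonal matrix whose antidiagonal entries are $1$ in the two corners and $-1$ elsewhere. Then $$A_{n,1}=\sum_{l=1}^{5}c_{1,l}R_{1,l}=-2\,I^{\otimes n}+S_n+S_n^\dagger-\tfrac12X^{\otimes n}+\tfrac12\left(-C_n^-\right),$$ that is, $A_{n,1}$ is a linear combination of the five unitaries $R_{1,1}=I^{\otimes n}$, $R_{1,2}=S_n$, $R_{1,3}=S_n^\dagger$, $R_{1,4}=X^{\otimes n}$, $R_{1,5}=-C_n^-$ with coefficients $-2,1,1,-\frac12,\frac12$, all in $\{1,-2,\pm\frac12\}$. Here $$-C_n^-=(X\otimes I^{\otimes n-1})\,B\,(X\otimes I^{\otimes n-1})\,(I\otimes C_{n-1}(Z))\,B\,(X\otimes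 I^{\otimes n-1}),\qquad B=\prod_{t=1}^{n-1}\mathrm{CNOT}(0,t),$$ where $C_k(Z)=\mathrm{diag}(1,\dots,1,-1)$ is the $2^k\times 2^k$ multi-controlled $Z$ gate, qubits are numbered from $0$ with qubit $0$ the first tensor factor, and $\mathrm{CNOT}(c,t)$ has control $c$ and target $t$. Moreover, there is an absolute constant $K$ such that for every $n\ge1$ and every $l$ the unitary $R_{1,l}$ can be implemented exactly on the $n$ qubits together with a single ancilla qubit (prepared in $|0\rangle$ and returned to $|0\rangle$) by a circuit with at most $2$ Hadamard gates and at most $Kn$ Toffoli, $X$ and $\mathrm{CNOT}$ gates in total. -/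

import Mathlib

open scoped Matrix Kronecker

noncomputable section

namespace DirichletLCU

/-! ## The discretized Dirichlet Laplacian on `(0,1)` with `2 ^ n` interior grid points -/

/-- The `N × N` tridiagonal matrix with `-2` on the diagonal and `1` next to it. -/
def tridiag (N : ℕ) : Matrix (Fin N) (Fin N) ℂ :=
  fun i j =>
    if i = j then -2
    else if (i : ℕ) = (j : ℕ) + 1 ∨ (j : ℕ) = (i : ℕ) + 1 then 1
    else 0

/-- The mesh width `h = 1 / (2 ^ n + 1)`. -/
def meshWidth (n : ℕ) : ℝ := 1 / ((2 : ℝ) ^ n + 1)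

/-- The finite-difference Dirichlet Laplacian `L = h⁻² · tridiag(1, -2, 1)`. -/
def laplacian (n : ℕ) : Matrix (Fin (2 ^ n)) (Fin (2 ^ n)) ℂ :=
  ((1 / meshWidth n ^ 2 : ℝ) : ℂ) • tridiag (2 ^ n)

/-- The normalized Dirichlet Laplacian `A = h² L`. -/
def normalizedLaplacian (n : ℕ) : Matrix (Fin (2 ^ n)) (Fin (2 ^ n)) ℂ :=
  ((meshWidth n ^ 2 : ℝ) : ℂ) • laplacian n

/-! ## Matrices on `n` qubits, indexed by `0, …, 2 ^ n - 1` -/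

/-- The Pauli `X` matrix. -/
def pauliX : Matrix (Fin 2) (Fin 2) ℂ := !![0, 1; 1, 0]

/-- The Hadamard matrix. -/
def hadamard : Matrix (Fin 2) (Fin 2) ℂ :=
  ((1 / Real.sqrt 2 : ℝ) : ℂ) • !![1, 1; 1, -1]

/-- The tensor product `U ⊗ M` of a one-qubit matrix and an `m`-qubit matrix: the Kronecker
product, with the row and column pair `(a, b)` numbered `a * 2 ^ m + b`. -/
def tensor {m : ℕ} (U : Matrix (Fin 2) (Fin 2) ℂ) (M : Matrix (Fin (2 ^ m)) (Fin (2 ^ m)) ℂ) :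
    Matrix (Fin (2 ^ (m + 1))) (Fin (2 ^ (m + 1))) ℂ :=
  Matrix.reindex (finProdFinEquiv.trans (finCongr (pow_succ' 2 m).symm))
    (finProdFinEquiv.trans (finCongr (pow_succ' 2 m).symm)) (U ⊗ₖ M)

/-- The tensor power `U ⊗ ⋯ ⊗ U` with `n` factors. -/
def tensorPow (U : Matrix (Fin 2) (Fin 2) ℂ) : (n : ℕ) → Matrix (Fin (2 ^ n)) (Fin (2 ^ n)) ℂ
  | 0 => 1
  | m + 1 => tensor U (tensorPow U m)

/-- The increment gate `S_n : |j⟩ ↦ |j + 1 mod 2 ^ n⟩`. -/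
def increment (n : ℕ) : Matrix (Fin (2 ^ n)) (Fin (2 ^ n)) ℂ :=
  fun i j => if (i : ℕ) = ((j : ℕ) + 1) % 2 ^ n then 1 else 0

/-- The matrix `C_n⁻`: on the antidiagonal, `1` in the two corners and `-1` elsewhere;
zero off the antidiagonal. -/
def cMinus (n : ℕ) : Matrix (Fin (2 ^ n)) (Fin (2 ^ n)) ℂ :=
  fun i j =>
    if (i : ℕ) + (j : ℕ) + 1 = 2 ^ n then
      (if (i : ℕ) = 0 ∨ (j : ℕ) = 0 then 1 else -1)
    else 0

/-- The multi-controlled `Z` gate `C_k(Z) = diag(1, …, 1, -1)`. -/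
def controlledZ (k : ℕ) : Matrix (Fin (2 ^ k)) (Fin (2 ^ k)) ℂ :=
  Matrix.diagonal fun i => if (i : ℕ) + 1 = 2 ^ k then -1 else 1

/-! ## Circuits -/

/-- The computational basis states of a register of `k` qubits, as bit strings. -/
abbrev Bits (k : ℕ) : Type := Fin k → Fin 2

/-- The number of a bit string; qubit `0` is the first tensor factor, hence the most significant
bit. -/
def basisEquiv (k : ℕ) : Bits k ≃ Fin (2 ^ k) :=
  (Equiv.arrowCongr Fin.revPerm (Equiv.refl (Fin 2))).trans finFunctionFinEquiv

theorem basisEquiv_val (k : ℕ) (x : Bits k) :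
    (basisEquiv k x : ℕ) = ∑ i : Fin k, (x i : ℕ) * 2 ^ (k - 1 - (i : ℕ)) := by
  rw [← Equiv.sum_comp Fin.revPerm]
  simp only [basisEquiv, Equiv.trans_apply, finFunctionFinEquiv_apply]
  refine Finset.sum_congr rfl fun i _ => ?_
  have h : k - 1 - (Fin.revPerm i : ℕ) = i := by
    rw [Fin.revPerm_apply, Fin.val_rev]; have := i.isLt; omega
  rw [h]
  simp [Equiv.arrowCongr]

/-- The elementary gates on a register of `k` qubits, at arbitrary pairwise distinct qubits. -/
inductive Gate (k : ℕ) : Type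
  | X (t : Fin k) : Gate k
  | H (t : Fin k) : Gate k
  | CNOT (c t : Fin k) (h : c ≠ t) : Gate k
  | Toffoli (c₁ c₂ t : Fin k) (h₁₂ : c₁ ≠ c₂) (h₁ : c₁ ≠ t) (h₂ : c₂ ≠ t) : Gate k

/-- The one-qubit matrix `U` acting on qubit `t` (and the identity on all others). -/
def onQubit {k : ℕ} (t : Fin k) (U : Matrix (Fin 2) (Fin 2) ℂ) : Matrix (Bits k) (Bits k) ℂ :=
  fun x y => if ∀ j, j ≠ t → x j = y j then U (x t) (y t) else 0

/-- The matrix that sends each basis state `|y⟩` to the basis state `|f y⟩`. -/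
def basisMap {k : ℕ} (f : Bits k → Bits k) : Matrix (Bits k) (Bits k) ℂ :=
  fun x y => if x = f y then 1 else 0

/-- The matrix of an elementary gate. Addition and multiplication in `Fin 2` are XOR and AND. -/
def Gate.matrix {k : ℕ} : Gate k → Matrix (Bits k) (Bits k) ℂ
  | .X t => onQubit t pauliX
  | .H t => onQubit t hadamard
  | .CNOT c t _ => basisMap fun y => Function.update y t (y t + y c)
  | .Toffoli c₁ c₂ t _ _ _ => basisMap fun y => Function.update y t (y t + y c₁ * y c₂)

/-- Whether an elementary gate is a Hadamard gate. -/
def Gate.isHadamard {k : ℕ} : Gate k → Bool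
  | .H _ => true
  | _ => false

/-- A circuit: a list of elementary gates, the first of which is applied first. -/
abbrev Circuit (k : ℕ) : Type := List (Gate k)

/-- The matrix of a circuit. -/
def Circuit.matrix {k : ℕ} : Circuit k → Matrix (Bits k) (Bits k) ℂ
  | [] => 1
  | g :: C => Circuit.matrix C * g.matrix

/-- The number of Hadamard gates in a circuit. -/
def Circuit.hadamardCount {k : ℕ} (C : Circuit k) : ℕ := C.countP fun g => g.isHadamard

/-- The number of `X`, `CNOT` and Toffoli gates in a circuit. -/
def Circuit.classicalCount {k : ℕ} (C : Circuit k) : ℕ := C.countP fun g => !g.isHadamard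

/-- A circuit on `n + 1` qubits, the last one being an ancilla prepared in the state `|0⟩`,
implements the `n`-qubit matrix `R` if it maps `|y⟩ ⊗ |0⟩` to `R|y⟩ ⊗ |0⟩` for every basis
state `|y⟩`. -/
def Circuit.Implements {n : ℕ} (C : Circuit (n + 1))
    (R : Matrix (Fin (2 ^ n)) (Fin (2 ^ n)) ℂ) : Prop :=
  ∀ (x y : Bits n) (a : Fin 2),
    Circuit.matrix C (Fin.snoc (α := fun _ => Fin 2) x a) (Fin.snoc (α := fun _ => Fin 2) y 0) =
      if a = 0 then R (basisEquiv n x) (basisEquiv n y) else 0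

/-! ## The decomposition -/

/-- The matrix of the gate `CNOT(c, t)` on `n` qubits, indexed by `0, …, 2 ^ n - 1`. -/
def cnot {n : ℕ} (c t : Fin n) (h : c ≠ t) : Matrix (Fin (2 ^ n)) (Fin (2 ^ n)) ℂ :=
  Matrix.reindex (basisEquiv n) (basisEquiv n) (Gate.CNOT c t h).matrix

/-- The product `B = CNOT(0,1) ⋯ CNOT(0,m)` on `m + 1` qubits. -/
def fanout (m : ℕ) : Matrix (Fin (2 ^ (m + 1))) (Fin (2 ^ (m + 1))) ℂ :=
  ((List.finRange m).map fun t => cnot 0 t.succ (Fin.succ_ne_zero t).symm).prod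

/-- The coefficients of the decomposition. -/
def coeff : Fin 5 → ℂ := ![-2, 1, 1, -1 / 2, 1 / 2]

/-- The unitaries of the decomposition: `I`, `S_n`, `S_n†`, `X ⊗ ⋯ ⊗ X` and `-C_n⁻`. -/
def term (n : ℕ) : Fin 5 → Matrix (Fin (2 ^ n)) (Fin (2 ^ n)) ℂ :=
  ![1, increment n, (increment n)ᴴ, tensorPow pauliX n, -cMinus n]

end DirichletLCU

end

/-!
All matrices involved are, in the computational basis, maps `|y⟩ ↦ σ y |f y⟩` with a sign `σ` and a
map `f` of bit strings (`signedMap`), so matrix identities become identities of Boolean functions.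
The decomposition holds entrywise: `S + S†` is the off-diagonal part of the tridiagonal matrix
together with the two corners, and `(X ⊗ ⋯ ⊗ X + C⁻) / 2` is exactly the corner part. The
factorization of `-C⁻` is a computation with bits: `-C⁻` negates all qubits and puts a sign on the
two constant bit strings.

For the gate count, `ClassicalCost f c` says that `f` is computed by `c` gates `X`, `CNOT` and
Toffoli. Two constructions carry the linear bound.

* A conjunction of `k` qubits can be added into a target with `O(k)` gates, using one other qubit
  in an arbitrary state (`ClassicalCost.xorInto_conj`). This rests on a Toffoli ladder through
  borrowed qubits whose effect on them is independent of their state, so that it can be run twice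
  (`exists_borrowed_ladder`).
* The increment is computed by halving (`ClassicalCost.exists_increment`). The high half changes
  only if all qubits of the low half are one; in that case the low half, negated, is a row of zeros
  in which the carries can be stored. A carry ladder that acts trivially, whatever the state of its
  storage, when its control is off (`ClassicalCost.exists_ripple_of_clean`) makes this work with one
  clean ancilla as the control, which is clean again for the recursion on the low half. So the cost
  satisfies `T(n) ≤ T(n / 2) + O(n)`, which is linear.

The gate `S†` is the increment conjugated by `X ⊗ ⋯ ⊗ X`. For `-C⁻` the ancilla is brought into the
state `(|0⟩ - |1⟩) / √2` by one Hadamard gate and back by another, and the indicator of the constant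
bit strings is added into it (`ClassicalCost.exists_implements_phase`, `exists_add_isConstant`).
-/

namespace DirichletLCU

/-! ### Signed basis maps -/

/-- The matrix `|y⟩ ↦ σ y |f y⟩`: a map of basis states, followed by a phase that depends on the
state it was applied to. -/
def signedMap {ι : Type*} [DecidableEq ι] (σ : ι → ℂ) (f : ι → ι) : Matrix ι ι ℂ :=
  fun x y => if x = f y then σ y else 0

theorem signedMap_mul {ι : Type*} [DecidableEq ι] [Fintype ι] (σ τ : ι → ℂ) (f g : ι → ι) :
    signedMap σ f * signedMap τ g = signedMap (fun y => σ (g y) * τ y) (f ∘ g) := by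
  ext x y
  simp [signedMap, Matrix.mul_apply]

theorem signedMap_one_id {ι : Type*} [DecidableEq ι] :
    signedMap (fun _ => 1) (id : ι → ι) = 1 := by
  ext x y
  simp [signedMap, Matrix.one_apply]

theorem signedMap_mem_unitaryGroup {ι : Type*} [DecidableEq ι] [Fintype ι] {σ : ι → ℂ}
    {f : ι → ι} (hf : Function.Injective f) (hσ : ∀ y, star (σ y) * σ y = 1) :
    signedMap σ f ∈ Matrix.unitaryGroup ι ℂ := by
  rw [Matrix.mem_unitaryGroup_iff']
  ext x y
  rw [Matrix.star_eq_conjTranspose, Matrix.mul_apply, Finset.sum_eq_single (f x)]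
  · by_cases h : x = y
    · subst h
      simpa [signedMap] using hσ x
    · simp [signedMap, h, hf.eq_iff]
  · intro z _ hz
    simp [signedMap, hz]
  · simp

theorem basisMap_mul {k : ℕ} (f g : Bits k → Bits k) :
    basisMap f * basisMap g = basisMap (f ∘ g) := by
  have h := signedMap_mul (fun _ => 1) (fun _ => 1) f g
  simp only [mul_one] at h
  exact h

theorem basisMap_id {k : ℕ} : basisMap (id : Bits k → Bits k) = 1 := signedMap_one_id

/-! ### Maps of bit strings computed by classical gates -/

theorem Circuit.matrix_append {k : ℕ} (C D : Circuit k) :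
    Circuit.matrix (C ++ D) = D.matrix * C.matrix := by
  induction C with
  | nil => simp [Circuit.matrix]
  | cons g C ih => rw [List.cons_append, Circuit.matrix, ih, Circuit.matrix, Matrix.mul_assoc]

/-- The map `f` of basis states is computed exactly by a circuit of at most `c` gates `X`, `CNOT`
and Toffoli, without Hadamard gates. -/
def ClassicalCost {k : ℕ} (f : Bits k → Bits k) (c : ℕ) : Prop :=
  ∃ C : Circuit k, C.hadamardCount = 0 ∧ C.classicalCount ≤ c ∧ C.matrix = basisMap f

/-- Adds (modulo 2) the bit `φ s` to the qubit `t` of the state `s`. -/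
def xorInto {k : ℕ} (t : Fin k) (φ : Bits k → Fin 2) (s : Bits k) : Bits k :=
  Function.update s t (s t + φ s)

/-- The conjunction of the qubits in `S`. -/
def conj {k : ℕ} (S : Finset (Fin k)) (s : Bits k) : Fin 2 := if ∀ w ∈ S, s w = 1 then 1 else 0

@[simp] theorem xorInto_self {k : ℕ} (t : Fin k) (φ : Bits k → Fin 2) (s : Bits k) :
    xorInto t φ s t = s t + φ s := by simp [xorInto]

theorem xorInto_of_ne {k : ℕ} {t w : Fin k} (h : w ≠ t) (φ : Bits k → Fin 2) (s : Bits k) :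
    xorInto t φ s w = s w := by simp [xorInto, h]

@[simp] theorem conj_empty {k : ℕ} (s : Bits k) : conj ∅ s = 1 := by simp [conj]

theorem bit_cases : ∀ b : Fin 2, b = 0 ∨ b = 1 := by decide

theorem conj_insert {k : ℕ} (x : Fin k) (S : Finset (Fin k)) (s : Bits k) :
    conj (insert x S) s = s x * conj S s := by
  rcases bit_cases (s x) with h | h <;> simp [conj, h]

theorem conj_congr {k : ℕ} {S : Finset (Fin k)} {s s' : Bits k} (h : ∀ w ∈ S, s w = s' w) :
    conj S s = conj S s' := by
  have : (∀ w ∈ S, s w = 1) ↔ ∀ w ∈ S, s' w = 1 := forall₂_congr fun w hw => by rw [h w hw]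
  simp only [conj, this]

theorem pauliX_apply (a b : Fin 2) : pauliX a b = if a = b + 1 then 1 else 0 := by
  fin_cases a <;> fin_cases b <;> simp [pauliX]

theorem onQubit_pauliX {k : ℕ} (t : Fin k) :
    onQubit t pauliX = basisMap (xorInto t fun _ => 1) := by
  ext x y
  have h : x = xorInto t (fun _ => 1) y ↔ (∀ j, j ≠ t → x j = y j) ∧ x t = y t + 1 := by
    constructor
    · rintro rfl
      exact ⟨fun j hj => xorInto_of_ne hj _ _, xorInto_self _ _ _⟩
    · rintro ⟨h1, h2⟩
      ext1 j
      by_cases hj : j = t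
      · rw [hj, h2, xorInto_self]
      · rw [h1 j hj, xorInto_of_ne hj]
  simp only [onQubit, basisMap, pauliX_apply, h, ite_and]

namespace ClassicalCost

variable {k : ℕ}

theorem mono {f : Bits k → Bits k} {a b : ℕ} (h : ClassicalCost f a) (hab : a ≤ b) :
    ClassicalCost f b := by
  obtain ⟨C, h1, h2, h3⟩ := h
  exact ⟨C, h1, h2.trans hab, h3⟩

theorem id : ClassicalCost (id : Bits k → Bits k) 0 :=
  ⟨[], rfl, le_rfl, basisMap_id.symm⟩

theorem comp {f g : Bits k → Bits k} {a b : ℕ} (hf : ClassicalCost f a)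
    (hg : ClassicalCost g b) : ClassicalCost (f ∘ g) (a + b) := by
  obtain ⟨C, h1, h2, h3⟩ := hf
  obtain ⟨D, h1', h2', h3'⟩ := hg
  refine ⟨D ++ C, ?_, ?_, ?_⟩
  · simp only [Circuit.hadamardCount, List.countP_append] at *
    omega
  · simp only [Circuit.classicalCount, List.countP_append] at *
    omega
  · rw [Circuit.matrix_append, h3, h3', basisMap_mul]

theorem ofGate (g : Gate k) (hg : g.isHadamard = false) {f : Bits k → Bits k}
    (hf : g.matrix = basisMap f) : ClassicalCost f 1 :=
  ⟨[g], by simp [Circuit.hadamardCount, hg], by simp [Circuit.classicalCount, hg],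
    by simp [Circuit.matrix, hf]⟩

theorem not (t : Fin k) : ClassicalCost (xorInto t fun _ => 1) 1 :=
  ofGate (.X t) rfl (onQubit_pauliX t)

theorem cnot {c t : Fin k} (h : c ≠ t) : ClassicalCost (xorInto t fun s => s c) 1 :=
  ofGate (.CNOT c t h) rfl rfl

/-- The two controls may coincide: the Toffoli gate is then replaced by a `CNOT`. -/
theorem toffoli {c₁ c₂ t : Fin k} (h₁ : c₁ ≠ t) (h₂ : c₂ ≠ t) :
    ClassicalCost (xorInto t fun s => s c₁ * s c₂) 1 := by
  by_cases h : c₁ = c₂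
  · subst h
    have key : ∀ b : Fin 2, b * b = b := by decide
    simpa only [key] using cnot h₁
  · exact ofGate (.Toffoli c₁ c₂ t h h₁ h₂) rfl rfl

/-- Adding a bit `φ` into all qubits of `T`, when `φ` does not depend on `T` and can be added to
a single qubit of `T` at cost `r`. -/
theorem xorOn {φ : Bits k → Fin 2} {r : ℕ} (T : Finset (Fin k))
    (hφ : ∀ s s' : Bits k, (∀ w ∉ T, s w = s' w) → φ s = φ s')
    (hT : ∀ t ∈ T, ClassicalCost (xorInto t φ) r) :
    ClassicalCost (fun s w => if w ∈ T then s w + φ s else s w) (r * T.card) := by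
  suffices H : ∀ U ⊆ T, ClassicalCost (fun s w => if w ∈ U then s w + φ s else s w) (r * U.card)
    from H T subset_rfl
  intro U
  induction U using Finset.induction_on with
  | empty => intro _; simpa using! id
  | insert t U htU ih =>
    intro hU
    rw [Finset.insert_subset_iff] at hU
    have := (hT t hU.1).comp (ih hU.2)
    rw [Finset.card_insert_of_notMem htU, Nat.mul_succ, add_comm]
    refine cast ?_ this
    congr 1
    funext s w
    have h2 : φ (fun w => if w ∈ U then s w + φ s else s w) = φ s :=
      hφ _ _ fun w hw => if_neg fun h => hw (hU.2 h)
    by_cases hw : w = t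
    · subst hw
      simp [h2, htU]
    · simp [xorInto_of_ne hw, hw]

end ClassicalCost

/-! ### Multi-controlled `X` gates with borrowed qubits -/

/-- A ladder of Toffoli gates through borrowed qubits `D` in an arbitrary state: it adds to `D`
an amount `δ` that depends on the controls `S` only, and which on some qubit of `D` is the
conjunction of `S`. Since the amount is independent of `D`, running the ladder twice restores
`D`. The recursion adds one control `x` and one borrowed qubit `e` by conjugation: adding
`x · d` into `e` before and after `d` receives the conjunction `P` leaves `x · P` in `e`. -/
theorem exists_borrowed_ladder {k : ℕ} {S : Finset (Fin k)} (hS : S.Nonempty) :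
    ∀ D : Finset (Fin k), Disjoint S D → S.card ≤ D.card →
      ∃ d ∈ D, ∃ δ : Bits k → Bits k, (∀ s, ∀ w ∉ D, δ s w = 0) ∧
        (∀ s s', (∀ w ∈ S, s w = s' w) → δ s = δ s') ∧ (∀ s, δ s d = conj S s) ∧
        ClassicalCost (fun s w => s w + δ s w) (2 * S.card) := by
  induction hS using Finset.Nonempty.cons_induction with
  | singleton x =>
    intro D hD hc
    obtain ⟨d, hd⟩ : D.Nonempty := Finset.card_pos.mp (by simpa using hc)
    have hxd : x ≠ d := by
      rintro rfl
      simp [hd] at hD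
    refine ⟨d, hd, fun s w => if w = d then s x else 0, ?_, ?_, ?_, ?_⟩
    · intro s w hw
      exact if_neg (ne_of_mem_of_not_mem hd hw).symm
    · intro s s' h
      simp only [h x (by simp)]
    · intro s
      rcases bit_cases (s x) with h | h <;> simp [conj, h]
    · refine cast ?_ ((ClassicalCost.cnot hxd).mono (by simp : 1 ≤ 2 * ({x} : Finset (Fin k)).card))
      congr 1
      funext s w
      by_cases hw : w = d
      · subst hw; simp
      · simp [xorInto_of_ne hw, hw]
  | cons x S hx hS ih =>
    intro D hD hc
    rw [Finset.cons_eq_insert] at *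
    rw [Finset.card_insert_of_notMem hx] at *
    rw [Finset.disjoint_insert_left] at hD
    obtain ⟨e, he⟩ : D.Nonempty := Finset.card_pos.mp (by omega)
    have hxe : x ≠ e := fun h => hD.1 (h ▸ he)
    have heS : e ∉ S := fun h => Finset.disjoint_left.mp hD.2 h he
    obtain ⟨d, hd, δ, h1, h2, h3, h4⟩ := ih (D.erase e) (hD.2.mono_right (Finset.erase_subset _ _))
      (by rw [Finset.card_erase_of_mem he]; omega)
    rw [Finset.mem_erase] at hd
    refine ⟨e, he, fun s w => if w = e then s x * conj S s else δ s w, ?_, ?_, ?_, ?_⟩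
    · intro s w hw
      simp only [if_neg (ne_of_mem_of_not_mem he hw).symm]
      exact h1 s w fun h => hw (Finset.mem_of_mem_erase h)
    · intro s s' h
      simp only [h x (by simp), conj_congr fun w hw => h w (Finset.mem_insert_of_mem hw),
        h2 s s' fun w hw => h w (Finset.mem_insert_of_mem hw)]
    · intro s
      simp [conj_insert]
    · have hT := ClassicalCost.toffoli hxe hd.1
      refine cast ?_ ((hT.comp (h4.comp hT)).mono (by omega : _ ≤ 2 * (S.card + 1)))
      congr 1
      funext s w
      have hδ : δ (xorInto e (fun s => s x * s d) s) = δ s :=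
        h2 _ _ fun w hw => xorInto_of_ne (ne_of_mem_of_not_mem hw heS) _ _
      have hδe : δ s e = 0 := h1 s e (by simp)
      have hδx : δ s x = 0 := h1 s x fun h => hD.1 (Finset.mem_of_mem_erase h)
      by_cases hw : w = e
      · subst hw
        simp only [Function.comp_apply, xorInto_self, hδ, hδe, hδx, h3, xorInto_of_ne hxe,
          xorInto_of_ne hd.1, if_true]
        generalize s w = a, s x = b, s d = c, conj S s = p
        revert a b c p
        decide
      · simp [xorInto_of_ne hw, hw, hδ]

/-- A multi-controlled `X` gate with nearly as many borrowed qubits `D` as controls `S`: a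
Toffoli gate from the ladder into the target on both sides of a run of the ladder, which is then
undone by a second run. -/
theorem ClassicalCost.xorInto_conj_of_card_le {k : ℕ} {S D : Finset (Fin k)} {t : Fin k}
    (hS : t ∉ S) (hD : t ∉ D) (hSD : Disjoint S D) (hc : S.card ≤ D.card + 1) :
    ClassicalCost (xorInto t (conj S)) (4 * S.card + 1) := by
  rcases S.eq_empty_or_nonempty with rfl | ⟨x, hxS⟩
  · have h : conj (∅ : Finset (Fin k)) = fun _ => 1 := funext conj_empty
    rw [h]
    exact ClassicalCost.not t
  obtain ⟨S, hx, rfl⟩ : ∃ S', x ∉ S' ∧ S = insert x S' :=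
    ⟨S.erase x, by simp, (Finset.insert_erase hxS).symm⟩
  rw [Finset.card_insert_of_notMem hx] at *
  have hxt : x ≠ t := by rintro rfl; exact hS hxS
  rcases S.eq_empty_or_nonempty with rfl | hne
  · refine cast ?_ ((ClassicalCost.cnot hxt).mono (by simp : 1 ≤ 4 * (0 + 1) + 1))
    congr 1
    funext s
    have : ∀ b : Fin 2, b * 1 = b := by decide
    simp only [xorInto, conj_insert, conj_empty, this]
  rw [Finset.disjoint_insert_left] at hSD
  rw [Finset.mem_insert, not_or] at hS
  obtain ⟨d, hd, δ, h1, h2, h3, h4⟩ := exists_borrowed_ladder hne D hSD.2 (by omega)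
  have hdt : d ≠ t := by rintro rfl; exact hD hd
  have hT := ClassicalCost.toffoli hxt hdt
  refine cast ?_ ((h4.comp (hT.comp (h4.comp hT))).mono (by omega : _ ≤ 4 * (S.card + 1) + 1))
  congr 1
  funext s w
  have hδT : ∀ s, δ (xorInto t (fun s => s x * s d) s) = δ s := fun s =>
    h2 _ _ fun w hw => xorInto_of_ne (ne_of_mem_of_not_mem hw hS.2) _ _
  have hδδ : ∀ s, δ (fun w => s w + δ s w) = δ s := fun s =>
    h2 _ _ fun w hw => by
      rw [h1 s w (Finset.disjoint_left.mp hSD.2 hw)]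
      simp
  have hδx : δ s x = 0 := h1 s x hSD.1
  have hδt : δ s t = 0 := h1 s t hD
  have hδδ' := hδδ (xorInto t (fun s => s x * s d) s)
  simp only [hδT] at hδδ'
  by_cases hw : w = t
  · subst hw
    simp only [Function.comp_apply, xorInto_self, hδT, hδδ', hδt, hδx, h3, conj_insert,
      xorInto_of_ne hxt, xorInto_of_ne hdt]
    generalize s w = a, s x = b, s d = c, conj S s = p
    revert a b c p
    decide
  · simp only [Function.comp_apply, xorInto_of_ne hw, hδT, hδδ']
    generalize s w = a, δ s w = b
    revert a b
    decide

/-- A multi-controlled `X` gate with a single borrowed qubit `a`. With `S = S₁ ∪ S₂`, the gates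
`S₁ → a` and `S₂ ∪ {a} → t` are alternated twice; each of them borrows the qubits on which only
the other one acts. -/
theorem ClassicalCost.xorInto_conj {k : ℕ} {S : Finset (Fin k)} {a t : Fin k}
    (ha : a ∉ S) (ht : t ∉ S) (hat : a ≠ t) :
    ClassicalCost (xorInto t (conj S)) (8 * S.card + 12) := by
  -- With this size of `U`, either gate has at most one control more than it has borrowed qubits:
  -- `|U| ≤ |V| + 1` and `|V| ≤ |U|`.
  obtain ⟨U, hUS, hU⟩ := Finset.exists_subset_card_eq (s := S) (n := (S.card + 1) / 2) (by omega)
  have hcard := Finset.card_sdiff_add_card_eq_card hUS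
  set V := S \ U with hV
  have hUV : Disjoint U V := Finset.disjoint_sdiff
  have hVS : V ⊆ S := Finset.sdiff_subset
  have haU : a ∉ U := fun h => ha (hUS h)
  have haV : a ∉ V := fun h => ha (hVS h)
  have htU : t ∉ U := fun h => ht (hUS h)
  have htV : t ∉ V := fun h => ht (hVS h)
  have hA : ClassicalCost (xorInto a (conj U)) (4 * U.card + 1) :=
    .xorInto_conj_of_card_le (D := insert t V) haU (by simp [hat, haV])
      (by simp [htU, hUV]) (by rw [Finset.card_insert_of_notMem htV]; omega)
  have hB : ClassicalCost (xorInto t (conj (insert a V))) (4 * (V.card + 1) + 1) := by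
    rw [← Finset.card_insert_of_notMem haV]
    exact .xorInto_conj_of_card_le (D := U) (by simp [hat.symm, htV]) htU
      (by simp [haU, hUV.symm]) (by rw [Finset.card_insert_of_notMem haV]; omega)
  refine cast ?_ ((hA.comp (hB.comp (hA.comp hB))).mono (by omega : _ ≤ 8 * S.card + 12))
  congr 1
  funext s w
  have hS : conj S s = conj U s * conj V s := by
    have : S = U ∪ V := by rw [hV, Finset.union_sdiff_of_subset hUS]
    rw [this]
    simp only [conj, Finset.mem_union, or_imp, forall_and]
    by_cases h : ∀ w ∈ U, s w = 1
    · rw [if_pos h]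
      by_cases h' : ∀ w ∈ V, s w = 1
      · rw [if_pos h', if_pos ⟨h, h'⟩, one_mul]
      · rw [if_neg h', if_neg fun hh => h' hh.2, mul_zero]
    · rw [if_neg h, if_neg fun hh => h hh.1, zero_mul]
  have hUt : ∀ φ s, conj U (xorInto t φ s) = conj U s := fun φ s =>
    conj_congr fun w hw => xorInto_of_ne (ne_of_mem_of_not_mem hw htU) _ _
  have hVt : ∀ φ s, conj V (xorInto t φ s) = conj V s := fun φ s =>
    conj_congr fun w hw => xorInto_of_ne (ne_of_mem_of_not_mem hw htV) _ _
  have hUa : ∀ φ s, conj U (xorInto a φ s) = conj U s := fun φ s =>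
    conj_congr fun w hw => xorInto_of_ne (ne_of_mem_of_not_mem hw haU) _ _
  have hVa : ∀ φ s, conj V (xorInto a φ s) = conj V s := fun φ s =>
    conj_congr fun w hw => xorInto_of_ne (ne_of_mem_of_not_mem hw haV) _ _
  by_cases hw : w = t
  · subst hw
    simp only [Function.comp_apply, xorInto_self, xorInto_of_ne hat.symm, xorInto_of_ne hat,
      conj_insert, hUt, hVt, hVa, hS]
    generalize s w = x, s a = b, conj U s = p, conj V s = q
    revert x b p q
    decide
  · by_cases hwa : w = a
    · subst hwa
      simp only [Function.comp_apply, xorInto_self, xorInto_of_ne hw, hUt, hUa]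
      generalize s w = x, conj U s = p
      revert x p
      decide
    · simp [xorInto_of_ne hw, xorInto_of_ne hwa]

/-! ### Ripple-carry increments with conditionally clean qubits -/

/-- Adds the carry `c` to the binary number held by the qubits of a list, least significant
qubit first; the carry out of the last qubit is dropped. -/
def ripple {k : ℕ} : Fin 2 → List (Fin k) → Bits k → Bits k
  | _, [], s => s
  | c, y :: ys, s => Function.update (ripple (c * s y) ys s) y (s y + c)

/-- The binary number held by the qubits of a list, least significant qubit first. -/
def listVal {k : ℕ} (s : Bits k) : List (Fin k) → ℕ
  | [] => 0
  | y :: ys => (s y : ℕ) + 2 * listVal s ys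

section ripple

variable {k : ℕ}

theorem ripple_of_notMem {w : Fin k} {ys : List (Fin k)} (h : w ∉ ys) (c : Fin 2) (s : Bits k) :
    ripple c ys s w = s w := by
  induction ys generalizing c with
  | nil => rfl
  | cons y ys ih =>
    simp only [List.mem_cons, not_or] at h
    simp [ripple, h.1, ih h.2]

/-- On its own qubits, `ripple` only depends on those. -/
theorem ripple_congr {ys : List (Fin k)} {s s' : Bits k} (h : ∀ w ∈ ys, s w = s' w) (c : Fin 2)
    {w : Fin k} (hw : w ∈ ys) : ripple c ys s w = ripple c ys s' w := by
  induction ys generalizing c with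
  | nil => simp at hw
  | cons y ys ih =>
    simp only [List.forall_mem_cons] at h
    by_cases hwy : w = y
    · subst hwy
      simp [ripple, h.1]
    · have hw' : w ∈ ys := by simpa [hwy] using hw
      simp [ripple, hwy, h.1, ih h.2 _ hw']

theorem ripple_zero (ys : List (Fin k)) (s : Bits k) : ripple 0 ys s = s := by
  induction ys with
  | nil => rfl
  | cons y ys ih => simp [ripple, ih]

theorem ripple_append {xs ys : List (Fin k)} (h : (xs ++ ys).Nodup) (c : Fin 2) (s : Bits k) :
    ripple c (xs ++ ys) s = ripple c xs (ripple (c * conj xs.toFinset s) ys s) := by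
  induction xs generalizing c with
  | nil =>
    have : ∀ b : Fin 2, b * 1 = b := by decide
    simp only [List.nil_append, ripple, List.toFinset_nil, conj_empty, this]
  | cons x xs ih =>
    rw [List.cons_append, List.nodup_cons, List.mem_append, not_or] at h
    have assoc : ∀ a b c : Fin 2, a * b * c = a * (b * c) := by decide
    simp only [List.cons_append, ripple, ih h.2, List.toFinset_cons, conj_insert, assoc,
      ripple_of_notMem h.1.2]

theorem listVal_congr {s s' : Bits k} {ys : List (Fin k)} (h : ∀ w ∈ ys, s w = s' w) :
    listVal s ys = listVal s' ys := by
  induction ys with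
  | nil => rfl
  | cons y ys ih =>
    simp only [List.forall_mem_cons] at h
    simp [listVal, h.1, ih h.2]

theorem listVal_ripple {ys : List (Fin k)} (h : ys.Nodup) (c : Fin 2) (s : Bits k) :
    listVal (ripple c ys s) ys = (listVal s ys + c) % 2 ^ ys.length := by
  induction ys generalizing c with
  | nil => simp [listVal, Nat.mod_one]
  | cons y ys ih =>
    rw [List.nodup_cons] at h
    have h1 : listVal (ripple c (y :: ys) s) ys = listVal (ripple (c * s y) ys s) ys :=
      listVal_congr fun w hw => by simp [ripple, ne_of_mem_of_not_mem hw h.1]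
    have h2 : ripple c (y :: ys) s y = s y + c := by simp [ripple]
    have h3 : ∀ a b : Fin 2, ((a + b : Fin 2) : ℕ) + 2 * ((b * a : Fin 2) : ℕ) = a + b := by decide
    have h4 : ((s y + c : Fin 2) : ℕ) < 2 := (s y + c).isLt
    have h5 := h3 (s y) c
    rw [listVal, h1, h2, ih h.2, listVal, List.length_cons, pow_succ', Nat.mod_mul]
    have h6 : (s y + 2 * listVal s ys + c : ℕ) % 2 = ((s y + c : Fin 2) : ℕ) := by omega
    have h7 : (s y + 2 * listVal s ys + c : ℕ) / 2 = listVal s ys + ((c * s y : Fin 2) : ℕ) := by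
      omega
    rw [h6, h7]

/-- A carry ladder on conditionally clean qubits: if the control `a` is off, nothing happens
whatever the state of the qubits `gs`; if it is on and the qubits `gs` are all zero, the bit `c`
is added to the number in the qubits `ys`. The carries are computed into `gs` and uncomputed
again, while only the writes into `ys` are controlled by `a`. -/
theorem ClassicalCost.exists_ripple_of_clean (a : Fin k) (ys gs : List (Fin k)) (c : Fin k)
    (hys : ys.Nodup) (hgs : gs.Nodup) (hd : ys.Disjoint gs) (hay : a ∉ ys) (hag : a ∉ gs)
    (hcy : c ∉ ys) (hcg : c ∉ gs) (hlen : ys.length ≤ gs.length + 1) :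
    ∃ f : Bits k → Bits k, ClassicalCost f (3 * ys.length) ∧ (∀ s, s a = 0 → f s = s) ∧
      ∀ s, s a = 1 → (∀ g ∈ gs, s g = 0) → f s = ripple (s c) ys s := by
  induction ys generalizing gs c with
  | nil => exact ⟨_, .id, fun _ _ => rfl, fun _ _ _ => rfl⟩
  | cons y ys ih =>
    simp only [List.mem_cons, not_or, List.nodup_cons] at hay hcy hys
    have key : ∀ b : Fin 2, b + 0 = b ∧ 0 * b = 0 ∧ 1 * b = b := by decide
    rcases gs with _ | ⟨g, gs⟩
    · obtain rfl : ys = [] := List.length_eq_zero_iff.mp (by simpa using hlen)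
      refine ⟨_, (ClassicalCost.toffoli hay.1 hcy.1).mono (by simp), ?_, ?_⟩
      · intro s hs
        simp [xorInto, hs]
      · intro s hs _
        simp [xorInto, hs, ripple, key]
    · simp only [List.mem_cons, not_or, List.nodup_cons] at hag hcg hgs
      simp only [List.disjoint_cons_left, List.disjoint_cons_right, List.mem_cons, not_or] at hd
      obtain ⟨⟨hgy, hgys⟩, -, hd⟩ := hd
      have hyg : y ≠ g := Ne.symm hgy
      obtain ⟨f, hf, hf0, hf1⟩ := ih gs g hys.2 hgs.2 hd hay.2 hag.2 hgys hgs.1 (by simpa using hlen)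
      have hT := ClassicalCost.toffoli (c₁ := c) (c₂ := y) (t := g) hcg.1 hyg
      have hU := ClassicalCost.toffoli (c₁ := a) (c₂ := c) (t := y) hay.1 hcy.1
      refine ⟨_, (hU.comp (hT.comp (hf.comp hT))).mono (by simp only [List.length_cons]; omega),
        ?_, ?_⟩
      · intro s hs
        have h1 := hf0 (xorInto g (fun s => s c * s y) s) (by rw [xorInto_of_ne hag.1, hs])
        simp only [Function.comp_apply, h1]
        have h2 : xorInto g (fun s => s c * s y) (xorInto g (fun s => s c * s y) s) = s := by
          funext w
          by_cases hw : w = g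
          · subst hw
            simp only [xorInto_self, xorInto_of_ne hcg.1, xorInto_of_ne hyg]
            generalize s w = x, s c = y, s y = z
            revert x y z
            decide
          · simp [xorInto_of_ne hw]
        rw [h2]
        funext w
        simp [xorInto, hs]
      · intro s hs hg
        simp only [List.forall_mem_cons] at hg
        set s₁ := xorInto g (fun s => s c * s y) s with hs₁
        have hne : ∀ w, w ≠ g → s₁ w = s w := fun w hw => xorInto_of_ne hw _ _
        have hs₁g : s₁ g = s c * s y := by simp [hs₁, hg.1]
        have h1 := hf1 s₁ (by rw [hne a hag.1, hs])
          fun w hw => by rw [hne w (ne_of_mem_of_not_mem hw hgs.1), hg.2 w hw]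
        simp only [Function.comp_apply, ← hs₁, h1, hs₁g]
        funext w
        by_cases hwy : w = y
        · subst hwy
          simp [ripple, xorInto_of_ne hyg, xorInto_of_ne hag.1, xorInto_of_ne hcg.1,
            ripple_of_notMem hys.1, ripple_of_notMem hay.2, ripple_of_notMem hcy.2, hne _ hyg,
            hne _ hag.1, hne _ hcg.1, hs]
        · rw [xorInto_of_ne hwy]
          simp only [ripple, Function.update_of_ne hwy]
          by_cases hwg : w = g
          · subst hwg
            simp only [xorInto_self, ripple_of_notMem hgys, ripple_of_notMem hys.1,
              ripple_of_notMem hcy.2, hne _ hyg, hne _ hcg.1, hs₁g, hg.1]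
            generalize s c = x, s y = z
            revert x z
            decide
          · rw [xorInto_of_ne hwg]
            by_cases hw : w ∈ ys
            · exact ripple_congr (fun v hv => hne v (ne_of_mem_of_not_mem hv hgys)) _ hw
            · rw [ripple_of_notMem hw, ripple_of_notMem hw, hne w hwg]

/-- An increment of linear cost with one clean ancilla `a`. The list is halved: the conjunction
of the low half is written into `a`, and if it is on, then the negated low half is a supply of
clean qubits for incrementing the high half. Once `a` has been restored, the low half is
incremented recursively, and the costs form a geometric series. -/
theorem ClassicalCost.exists_increment (a : Fin k) (L : List (Fin k)) (hL : L.Nodup)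
    (ha : a ∉ L) :
    ∃ f : Bits k → Bits k, ClassicalCost f (46 * L.length) ∧
      ∀ s, s a = 0 → f s = ripple 1 L s := by
  induction hn : L.length using Nat.strong_induction_on generalizing L with
  | _ n ih =>
  subst hn
  rcases L with _ | ⟨x, _ | ⟨x', L'⟩⟩
  · exact ⟨_, .id, fun _ _ => rfl⟩
  · exact ⟨_, (ClassicalCost.not x).mono (by simp), fun s _ => by simp [ripple, xorInto]⟩
  set L := x :: x' :: L' with hLdef
  have hlen : 2 ≤ L.length := by simp [hLdef]
  clear_value L
  -- Besides the recursion, a level costs at most `11 |L| + 24`, which is at most `23 |L|` as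
  -- `|L| ≥ 2`; the constant `46` is twice that, since the recursion halves the length.
  set lo := L.take (L.length / 2) with hlo
  set hi := L.drop (L.length / 2) with hhi
  have happ : lo ++ hi = L := List.take_append_drop _ _
  have hlolen : lo.length = L.length / 2 := by rw [hlo, List.length_take]; omega
  have hhilen : hi.length = L.length - L.length / 2 := by rw [hhi, List.length_drop]
  clear_value lo hi
  rw [← happ, List.nodup_append'] at hL
  obtain ⟨hlond, hhind, hdisj⟩ := hL
  rw [← happ, List.mem_append, not_or] at ha
  obtain ⟨b, hb⟩ : ∃ b, b ∈ hi := List.exists_mem_of_length_pos (by omega)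
  have hcard : lo.toFinset.card = lo.length := List.toFinset_card_of_nodup hlond
  have hM : ClassicalCost (xorInto a (conj lo.toFinset)) (8 * lo.length + 12) := by
    rw [← hcard]
    exact .xorInto_conj (a := b) (by simpa using fun h => hdisj h hb) (by simpa using ha.1)
      (ne_of_mem_of_not_mem hb ha.2)
  have hN := ClassicalCost.xorOn (φ := fun _ => 1) lo.toFinset (fun _ _ _ => rfl)
    fun t _ => ClassicalCost.not t
  rw [hcard] at hN
  obtain ⟨q, hq, hq0, hq1⟩ := ClassicalCost.exists_ripple_of_clean a hi lo a hhind hlond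
    hdisj.symm ha.2 ha.1 ha.2 ha.1 (by omega)
  obtain ⟨r, hr, hr'⟩ := ih lo.length (by omega) lo hlond ha.1 rfl
  refine ⟨_, (hr.comp (hM.comp (hN.comp (hq.comp (hN.comp hM))))).mono (by omega), ?_⟩
  intro s hs
  set N : Bits k → Bits k := fun s w => if w ∈ lo.toFinset then s w + 1 else s w with hNdef
  have hNlo : ∀ s, ∀ w ∈ lo, N s w = s w + 1 := fun s w hw => by simp [hNdef, hw]
  have hNne : ∀ s, ∀ w ∉ lo, N s w = s w := fun s w hw => by simp [hNdef, hw]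
  clear_value N
  have add11 : ∀ b : Fin 2, b + 1 + 1 = b := by decide
  have one_mul' : ∀ b : Fin 2, 1 * b = b := by decide
  have hNN : ∀ s, N (N s) = s := fun s => by
    funext w
    by_cases hw : w ∈ lo
    · rw [hNlo _ w hw, hNlo _ w hw, add11]
    · rw [hNne _ w hw, hNne _ w hw]
  have hMlo : ∀ φ s, ∀ w ≠ a, xorInto a φ s w = s w := fun φ s w hw => xorInto_of_ne hw φ s
  simp only [Function.comp_apply]
  rw [← happ, ripple_append (List.nodup_append'.mpr ⟨hlond, hhind, hdisj⟩), one_mul']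
  rcases bit_cases (conj lo.toFinset s) with hP | hP
  -- No carry into the high half: the ancilla stays off and everything on `hi` cancels.
  · have h1 : xorInto a (conj lo.toFinset) s = s := by simp [xorInto, hP]
    rw [h1, hq0 _ (by rw [hNne _ _ ha.1, hs]), hNN, h1, hr' s hs, hP, ripple_zero]
  -- The low half is all ones, so its negation is clean storage for the carries.
  · have hlo1 : ∀ w ∈ lo, s w = 1 := by
      by_contra h
      simp [conj, h] at hP
    set s₁ := xorInto a (conj lo.toFinset) s with hs₁
    have hs₁a : s₁ a = 1 := by simp [hs₁, hs, hP]
    have hs₁ne : ∀ w ≠ a, s₁ w = s w := fun w hw => hMlo _ _ w hw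
    clear_value s₁
    rw [hq1 (N s₁) (by rw [hNne _ _ ha.1, hs₁a]) fun w hw => by
      rw [hNlo _ w hw, hs₁ne w (ne_of_mem_of_not_mem hw ha.1), hlo1 w hw]; rfl]
    rw [hNne _ a ha.1, hs₁a, hP]
    have h2 : N (ripple 1 hi (N s₁)) = ripple 1 hi s₁ := by
      funext w
      by_cases hw : w ∈ lo
      · rw [hNlo _ w hw, ripple_of_notMem (hdisj hw), ripple_of_notMem (hdisj hw), hNlo _ w hw,
          add11]
      · rw [hNne _ w hw]
        by_cases hw' : w ∈ hi
        · exact ripple_congr (fun v hv => hNne _ v fun h => hdisj h hv) _ hw'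
        · rw [ripple_of_notMem hw', ripple_of_notMem hw', hNne _ w hw]
    have h3 : conj lo.toFinset (ripple 1 hi s₁) = 1 := by
      rw [← hP]
      refine conj_congr fun w hw => ?_
      rw [List.mem_toFinset] at hw
      rw [ripple_of_notMem (hdisj hw), hs₁ne w (ne_of_mem_of_not_mem hw ha.1)]
    have h4 : xorInto a (conj lo.toFinset) (ripple 1 hi s₁) = ripple 1 hi s := by
      funext w
      by_cases hw : w = a
      · subst hw
        rw [xorInto_self, h3, ripple_of_notMem ha.2, ripple_of_notMem ha.2, hs₁a, hs]
        rfl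
      · rw [xorInto_of_ne hw]
        by_cases hw' : w ∈ hi
        · exact ripple_congr (fun v hv => hs₁ne v (ne_of_mem_of_not_mem hv ha.2)) _ hw'
        · rw [ripple_of_notMem hw', ripple_of_notMem hw', hs₁ne w hw]
    rw [h2, h4, hr' _ (by rw [ripple_of_notMem ha.2, hs])]

end ripple

/-! ### Numbers of bit strings and matrices indexed by them -/

/-- The bitwise negation of a bit string. -/
def negate {k : ℕ} (y : Bits k) : Bits k := fun i => y i + 1

theorem negate_negate {k : ℕ} (y : Bits k) : negate (negate y) = y := by
  have : ∀ b : Fin 2, b + 1 + 1 = b := by decide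
  exact funext fun i => this (y i)

theorem basisEquiv_succ_val {m : ℕ} (x : Bits (m + 1)) :
    (basisEquiv (m + 1) x : ℕ) = x 0 * 2 ^ m + basisEquiv m (Fin.tail x) := by
  rw [basisEquiv_val, Fin.sum_univ_succ, basisEquiv_val]
  congr 1
  refine Finset.sum_congr rfl fun i _ => ?_
  rw [Fin.val_succ, show m + 1 - 1 - ((i : ℕ) + 1) = m - 1 - i by omega]
  rfl

theorem basisEquiv_negate {m : ℕ} (y : Bits m) :
    (basisEquiv m (negate y) : ℕ) + basisEquiv m y + 1 = 2 ^ m := by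
  induction m with
  | zero =>
    have h1 := (basisEquiv 0 (negate y)).isLt
    have h2 := (basisEquiv 0 y).isLt
    simp only [pow_zero] at *
    omega
  | succ m ih =>
    have h := ih (Fin.tail y)
    rw [basisEquiv_succ_val, basisEquiv_succ_val]
    change ((y 0 + 1 : Fin 2) : ℕ) * 2 ^ m + (basisEquiv m (negate (Fin.tail y)) : ℕ) + _ + 1 = _
    rw [pow_succ]
    rcases bit_cases (y 0) with h0 | h0 <;> rw [h0] <;>
      simp only [Fin.isValue, zero_add, Fin.val_one, Fin.val_zero, Fin.reduceAdd] <;> omega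

theorem basisEquiv_add_basisEquiv_add_one {n : ℕ} (x y : Bits n) :
    (basisEquiv n x : ℕ) + basisEquiv n y + 1 = 2 ^ n ↔ x = negate y := by
  constructor
  · intro h
    have := basisEquiv_negate y
    exact (basisEquiv n).injective (Fin.ext (by omega))
  · rintro rfl
    exact basisEquiv_negate y

theorem basisEquiv_eq_zero {n : ℕ} (x : Bits n) :
    (basisEquiv n x : ℕ) = 0 ↔ ∀ i, x i = 0 := by
  simp [basisEquiv_val, Finset.sum_eq_zero_iff]

theorem basisEquiv_add_one {n : ℕ} (x : Bits n) :
    (basisEquiv n x : ℕ) + 1 = 2 ^ n ↔ ∀ i, x i = 1 := by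
  have h1 := basisEquiv_negate x
  have h2 := basisEquiv_eq_zero (negate x)
  have h3 : ∀ b : Fin 2, b + 1 = 0 ↔ b = 1 := by decide
  have h4 : (∀ i, negate x i = 0) ↔ ∀ i, x i = 1 := forall_congr' fun i => h3 (x i)
  rw [← h4, ← h2]
  omega

theorem reindex_apply_basisEquiv {n : ℕ} (M : Matrix (Bits n) (Bits n) ℂ) (x y : Bits n) :
    Matrix.reindex (basisEquiv n) (basisEquiv n) M (basisEquiv n x) (basisEquiv n y) = M x y := by
  simp

theorem eq_reindex_of_apply {n : ℕ} {A : Matrix (Fin (2 ^ n)) (Fin (2 ^ n)) ℂ}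
    {M : Matrix (Bits n) (Bits n) ℂ} (h : ∀ x y, A (basisEquiv n x) (basisEquiv n y) = M x y) :
    A = Matrix.reindex (basisEquiv n) (basisEquiv n) M := by
  ext i j
  obtain ⟨x, rfl⟩ := (basisEquiv n).surjective i
  obtain ⟨y, rfl⟩ := (basisEquiv n).surjective j
  rw [h, reindex_apply_basisEquiv]

theorem reindex_signedMap_mul {n : ℕ} (σ τ : Bits n → ℂ) (f g : Bits n → Bits n) :
    Matrix.reindex (basisEquiv n) (basisEquiv n) (signedMap σ f) *
        Matrix.reindex (basisEquiv n) (basisEquiv n) (signedMap τ g) =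
      Matrix.reindex (basisEquiv n) (basisEquiv n)
        (signedMap (fun y => σ (g y) * τ y) (f ∘ g)) := by
  rw [← signedMap_mul]
  simp only [Matrix.reindex_apply, Matrix.submatrix_mul_equiv]

theorem reindex_signedMap {n : ℕ} (σ : Bits n → ℂ) (f : Bits n → Bits n) :
    Matrix.reindex (basisEquiv n) (basisEquiv n) (signedMap σ f) =
      signedMap (σ ∘ (basisEquiv n).symm) (basisEquiv n ∘ f ∘ (basisEquiv n).symm) := by
  symm
  refine eq_reindex_of_apply fun x y => ?_
  simp [signedMap]

theorem tensor_apply_basisEquiv {m : ℕ} (U : Matrix (Fin 2) (Fin 2) ℂ)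
    (M : Matrix (Fin (2 ^ m)) (Fin (2 ^ m)) ℂ) (x y : Bits (m + 1)) :
    tensor U M (basisEquiv (m + 1) x) (basisEquiv (m + 1) y) =
      U (x 0) (y 0) * M (basisEquiv m (Fin.tail x)) (basisEquiv m (Fin.tail y)) := by
  have key : ∀ x : Bits (m + 1),
      (finProdFinEquiv.trans (finCongr (pow_succ' 2 m).symm)).symm (basisEquiv (m + 1) x) =
        (x 0, basisEquiv m (Fin.tail x)) := by
    intro x
    rw [Equiv.symm_apply_eq]
    apply Fin.ext
    rw [basisEquiv_succ_val]
    simp only [Equiv.trans_apply, finCongr_apply, Fin.val_cast, finProdFinEquiv_apply_val]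
    ring
  rw [tensor, Matrix.reindex_apply, Matrix.submatrix_apply, key, key, Matrix.kroneckerMap_apply]

theorem eq_iff_head_tail {m : ℕ} {x y : Bits (m + 1)} :
    x = y ↔ x 0 = y 0 ∧ Fin.tail x = Fin.tail y := by
  rw [funext_iff, Fin.forall_fin_succ, funext_iff]
  rfl

/-! ### The five unitaries as maps of bit strings -/

theorem tensorPow_pauliX (n : ℕ) : tensorPow pauliX n =
    Matrix.reindex (basisEquiv n) (basisEquiv n) (signedMap (fun _ => 1) negate) := by
  induction n with
  | zero =>
    refine eq_reindex_of_apply fun x y => ?_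
    have h : x = y := Subsingleton.elim _ _
    have h' : y = negate y := Subsingleton.elim _ _
    simp [tensorPow, signedMap, h, ← h', Matrix.one_apply]
  | succ m ih =>
    refine eq_reindex_of_apply fun x y => ?_
    rw [tensorPow, tensor_apply_basisEquiv, ih, reindex_apply_basisEquiv, pauliX_apply]
    have h : x = negate y ↔ x 0 = y 0 + 1 ∧ Fin.tail x = negate (Fin.tail y) := eq_iff_head_tail
    simp only [signedMap, h, ite_and, ite_mul, one_mul, zero_mul]

theorem tensorPow_pauliX_apply {n : ℕ} (i j : Fin (2 ^ n)) :
    tensorPow pauliX n i j = if (i : ℕ) + j + 1 = 2 ^ n then 1 else 0 := by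
  obtain ⟨x, rfl⟩ := (basisEquiv n).surjective i
  obtain ⟨y, rfl⟩ := (basisEquiv n).surjective j
  rw [tensorPow_pauliX, reindex_apply_basisEquiv]
  simp only [signedMap, basisEquiv_add_basisEquiv_add_one]

theorem neg_cMinus_eq (m : ℕ) : -cMinus (m + 1) =
    Matrix.reindex (basisEquiv (m + 1)) (basisEquiv (m + 1))
      (signedMap (fun y => if ∀ i, y i = y 0 then -1 else 1) negate) := by
  refine eq_reindex_of_apply fun x y => ?_
  simp only [Matrix.neg_apply, cMinus, signedMap, basisEquiv_add_basisEquiv_add_one]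
  by_cases h : x = negate y
  · subst h
    have h1 : (∀ i, y i = y 0) ↔
        (basisEquiv _ (negate y) : ℕ) = 0 ∨ (basisEquiv _ y : ℕ) = 0 := by
      have h3 : ∀ b : Fin 2, b + 1 = 0 ↔ b = 1 := by decide
      simp only [basisEquiv_eq_zero, negate, h3]
      constructor
      · intro h
        rcases bit_cases (y 0) with h0 | h0
        · exact .inr fun i => (h i).trans h0
        · exact .inl fun i => (h i).trans h0
      · rintro (h | h) i <;> rw [h i, h 0]
    simp only [h1]
    split_ifs <;> simp
  · simp [h]

theorem increment_eq (n : ℕ) : increment n = signedMap (fun _ => 1)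
    fun j => ⟨((j : ℕ) + 1) % 2 ^ n, Nat.mod_lt _ (by positivity)⟩ := by
  ext i j
  simp [increment, signedMap, Fin.ext_iff]

theorem negate_injective {k : ℕ} : Function.Injective (negate : Bits k → Bits k) :=
  Function.LeftInverse.injective negate_negate

theorem reindex_signedMap_mem_unitaryGroup {n : ℕ} {σ : Bits n → ℂ} {f : Bits n → Bits n}
    (hf : Function.Injective f) (hσ : ∀ y, star (σ y) * σ y = 1) :
    Matrix.reindex (basisEquiv n) (basisEquiv n) (signedMap σ f) ∈
      Matrix.unitaryGroup (Fin (2 ^ n)) ℂ := by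
  rw [reindex_signedMap]
  exact signedMap_mem_unitaryGroup
    ((basisEquiv n).injective.comp (hf.comp (basisEquiv n).symm.injective)) fun _ => hσ _

theorem increment_mem_unitaryGroup (n : ℕ) :
    increment n ∈ Matrix.unitaryGroup (Fin (2 ^ n)) ℂ := by
  rw [increment_eq]
  refine signedMap_mem_unitaryGroup (fun i j h => ?_) fun _ => by simp
  have h' : (i : ℕ) + 1 ≡ j + 1 [MOD 2 ^ n] := Fin.ext_iff.mp h
  exact Fin.ext ((Nat.ModEq.add_right_cancel' 1 h').eq_of_lt_of_lt i.isLt j.isLt)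

theorem term_mem_unitaryGroup {n : ℕ} (hn : 1 ≤ n) (l : Fin 5) :
    term n l ∈ Matrix.unitaryGroup (Fin (2 ^ n)) ℂ := by
  obtain ⟨m, rfl⟩ : ∃ m, n = m + 1 := ⟨n - 1, by omega⟩
  fin_cases l
  · exact one_mem _
  · exact increment_mem_unitaryGroup _
  · exact Unitary.star_mem (increment_mem_unitaryGroup _)
  · change tensorPow pauliX _ ∈ _
    rw [tensorPow_pauliX]
    exact reindex_signedMap_mem_unitaryGroup negate_injective fun _ => by simp
  · change -cMinus _ ∈ _
    rw [neg_cMinus_eq]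
    refine reindex_signedMap_mem_unitaryGroup negate_injective fun y => ?_
    split_ifs <;> simp

/-! ### The linear combination -/

theorem normalizedLaplacian_eq_tridiag (n : ℕ) : normalizedLaplacian n = tridiag (2 ^ n) := by
  have h : meshWidth n ≠ 0 := by
    unfold meshWidth
    positivity
  rw [normalizedLaplacian, laplacian, smul_smul, ← Complex.ofReal_mul, mul_one_div_cancel
    (pow_ne_zero 2 h), Complex.ofReal_one, one_smul]

/-- `S + S†` is the tridiagonal part together with the two corners, and
`-(X ⊗ ⋯ ⊗ X + C⁻) / 2` cancels the corners. -/
theorem normalizedLaplacian_eq {n : ℕ} (hn : 1 ≤ n) :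
    normalizedLaplacian n =
      (-2 : ℂ) • (1 : Matrix (Fin (2 ^ n)) (Fin (2 ^ n)) ℂ) + increment n + (increment n)ᴴ
        - (1 / 2 : ℂ) • tensorPow pauliX n - (1 / 2 : ℂ) • cMinus n := by
  have hN : 2 ≤ 2 ^ n := by
    calc 2 = 2 ^ 1 := rfl
      _ ≤ 2 ^ n := Nat.pow_le_pow_right (by norm_num) hn
  rw [normalizedLaplacian_eq_tridiag]
  ext i j
  simp only [Matrix.sub_apply, Matrix.add_apply, Matrix.smul_apply, Matrix.one_apply,
    Matrix.conjTranspose_apply, tensorPow_pauliX_apply, tridiag, increment, cMinus, Fin.ext_iff]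
  obtain ⟨a, hi⟩ := i
  obtain ⟨b, hj⟩ := j
  simp only
  generalize 2 ^ n = N at *
  have hmod : ∀ c < N, (c + 1) % N = if c + 1 = N then 0 else c + 1 := by
    intro c hc
    split_ifs with h
    · rw [h, Nat.mod_self]
    · exact Nat.mod_eq_of_lt (by omega)
  have e1 : (a = (b + 1) % N) ↔ (a = b + 1 ∨ (a = 0 ∧ b + 1 = N)) := by
    rw [hmod b hj]
    split_ifs <;> omega
  have e2 : (b = (a + 1) % N) ↔ (b = a + 1 ∨ (b = 0 ∧ a + 1 = N)) := by
    rw [hmod a hi]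
    split_ifs <;> omega
  simp only [e1, e2]
  split_ifs <;> first | omega | (norm_num)

theorem sum_coeff_smul_term (n : ℕ) : ∑ l : Fin 5, coeff l • term n l =
    (-2 : ℂ) • (1 : Matrix (Fin (2 ^ n)) (Fin (2 ^ n)) ℂ) + increment n + (increment n)ᴴ
      - (1 / 2 : ℂ) • tensorPow pauliX n - (1 / 2 : ℂ) • cMinus n := by
  have h : (-1 / 2 : ℂ) = -(1 / 2) := by norm_num
  simp only [Fin.sum_univ_five]
  change (-2 : ℂ) • 1 + (1 : ℂ) • increment n + (1 : ℂ) • (increment n)ᴴ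
    + (-1 / 2 : ℂ) • tensorPow pauliX n + (1 / 2 : ℂ) • -cMinus n = _
  rw [one_smul, one_smul, h, neg_smul (1 / 2 : ℂ), smul_neg, sub_eq_add_neg, sub_eq_add_neg]

theorem coeff_mem (l : Fin 5) : coeff l ∈ ({1, -2, 1 / 2, -(1 / 2)} : Set ℂ) := by
  have h : (-1 / 2 : ℂ) = -(1 / 2) := by norm_num
  fin_cases l <;> simp [coeff, h]

/-! ### The factorization of `-C⁻` -/

theorem tensor_pauliX_one (m : ℕ) : tensor pauliX (1 : Matrix (Fin (2 ^ m)) (Fin (2 ^ m)) ℂ) =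
    Matrix.reindex (basisEquiv (m + 1)) (basisEquiv (m + 1))
      (signedMap (fun _ => 1) (xorInto 0 fun _ => 1)) := by
  refine eq_reindex_of_apply fun x y => ?_
  have h : x = xorInto 0 (fun _ => 1) y ↔ x 0 = y 0 + 1 ∧ Fin.tail x = Fin.tail y := by
    rw [eq_iff_head_tail, xorInto_self]
    have : Fin.tail (xorInto 0 (fun _ => 1) y) = Fin.tail y :=
      funext fun i => xorInto_of_ne (Fin.succ_ne_zero i) _ _
    rw [this]
  rw [tensor_apply_basisEquiv, pauliX_apply]
  simp only [signedMap, h, ite_and, Matrix.one_apply, (basisEquiv m).injective.eq_iff, ite_mul,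
    one_mul, zero_mul]

theorem tensor_one_controlledZ (m : ℕ) : tensor 1 (controlledZ m) =
    Matrix.reindex (basisEquiv (m + 1)) (basisEquiv (m + 1))
      (signedMap (fun y => if ∀ i, Fin.tail y i = 1 then -1 else 1) id) := by
  refine eq_reindex_of_apply fun x y => ?_
  rw [tensor_apply_basisEquiv]
  simp only [controlledZ, Matrix.diagonal_apply, signedMap, Matrix.one_apply, id,
    (basisEquiv m).injective.eq_iff, basisEquiv_add_one, eq_iff_head_tail (x := x)]
  by_cases h0 : x 0 = y 0 <;> by_cases h1 : Fin.tail x = Fin.tail y <;> simp [h0, h1]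

theorem fanout_eq (m : ℕ) : fanout m =
    Matrix.reindex (basisEquiv (m + 1)) (basisEquiv (m + 1))
      (signedMap (fun _ => 1) fun y i => if i = 0 then y i else y i + y 0) := by
  have key : ∀ l : List (Fin m), l.Nodup →
      (l.map fun t => cnot (0 : Fin (m + 1)) t.succ (Fin.succ_ne_zero t).symm).prod =
        Matrix.reindex (basisEquiv (m + 1)) (basisEquiv (m + 1))
          (signedMap (fun _ => 1) fun y i => if i ∈ l.map Fin.succ then y i + y 0 else y i) := by
    intro l hl
    induction l with
    | nil =>
      have : (1 : Matrix (Bits (m + 1)) (Bits (m + 1)) ℂ) = signedMap (fun _ => 1)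
          fun y i => if i ∈ ([] : List (Fin m)).map Fin.succ then y i + y 0 else y i := by
        rw [← signedMap_one_id]
        simp
        rfl
      rw [← this]
      simp
    | cons t l ih =>
      rw [List.nodup_cons] at hl
      have ht : cnot (0 : Fin (m + 1)) t.succ (Fin.succ_ne_zero t).symm =
          Matrix.reindex (basisEquiv (m + 1)) (basisEquiv (m + 1))
            (signedMap (fun _ => 1) (xorInto t.succ fun s => s 0)) := rfl
      rw [List.map_cons, List.prod_cons, ih hl.2, ht, reindex_signedMap_mul]
      congr 2
      · simp
      · funext y i
        have h0 : ∀ l : List (Fin m), (0 : Fin (m + 1)) ∉ l.map Fin.succ := fun l h => by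
          obtain ⟨a, -, ha⟩ := List.mem_map.mp h
          exact Fin.succ_ne_zero a ha
        by_cases hi : i = t.succ
        · have h1 : t.succ ∉ l.map Fin.succ := fun h => by
            obtain ⟨a, ha, hat⟩ := List.mem_map.mp h
            exact hl.1 (Fin.succ_injective _ hat ▸ ha)
          subst hi
          simp only [Function.comp_apply, xorInto_self, if_neg h1, if_neg (h0 l), List.map_cons,
            List.mem_cons, true_or, if_true]
        · simp only [Function.comp_apply, xorInto_of_ne hi, List.map_cons, List.mem_cons, hi,
            false_or]
  rw [fanout, key _ (List.nodup_finRange m)]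
  congr 2
  funext y i
  refine Fin.cases ?_ (fun j => ?_) i
  · simp
  · simp

/-- Before the controlled `Z`, the first qubit has been negated and its negation added to all
others, so that the sign is applied to the two constant bit strings; the remaining gates complete
the negation of all qubits. -/
theorem neg_cMinus_factorization (m : ℕ) :
    -cMinus (m + 1) =
      tensor pauliX 1 * fanout m * tensor pauliX 1 * tensor 1 (controlledZ m) * fanout m *
        tensor pauliX 1 := by
  rw [neg_cMinus_eq, tensor_pauliX_one, tensor_one_controlledZ, fanout_eq]
  simp only [reindex_signedMap_mul]
  congr 2
  · funext y
    simp only [one_mul, mul_one, Fin.tail, xorInto_self, Fin.succ_ne_zero, if_false]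
    congr 1
    rw [eq_iff_iff, Fin.forall_fin_succ]
    simp only [true_and]
    refine forall_congr' fun i => ?_
    rw [xorInto_of_ne (Fin.succ_ne_zero i)]
    generalize y i.succ = a, y 0 = b
    revert a b
    decide
  · funext y i
    refine Fin.cases ?_ (fun j => ?_) i
    · simp only [Function.comp_apply, xorInto_self, if_true, id, negate]
      generalize y 0 = a
      revert a
      decide
    · simp only [Function.comp_apply, xorInto_self, xorInto_of_ne (Fin.succ_ne_zero _),
        Fin.succ_ne_zero, if_false, if_true, id, negate]
      generalize y j.succ = a, y 0 = b
      revert a b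
      decide

/-! ### Circuits with one ancilla qubit -/

/-- The qubits of an `n`-qubit register, from the least to the most significant, inside the
register extended by an ancilla. -/
def register (n : ℕ) : List (Fin (n + 1)) := List.ofFn fun i : Fin n => (Fin.rev i).castSucc

theorem register_nodup (n : ℕ) : (register n).Nodup :=
  List.nodup_ofFn.mpr fun _ _ h => Fin.rev_injective (Fin.castSucc_injective n h)

theorem length_register (n : ℕ) : (register n).length = n := List.length_ofFn

theorem last_notMem_register (n : ℕ) : Fin.last n ∉ register n := by
  simp [register, List.mem_ofFn, Fin.castSucc_ne_last]

theorem listVal_ofFn {k n : ℕ} (w : Fin n → Fin k) (s : Bits k) :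
    listVal s (List.ofFn w) = ∑ i : Fin n, (s (w i) : ℕ) * 2 ^ (i : ℕ) := by
  induction n with
  | zero => simp [listVal]
  | succ n ih =>
    rw [List.ofFn_succ, listVal, ih, Fin.sum_univ_succ, Finset.mul_sum]
    congr 1
    · simp
    · refine Finset.sum_congr rfl fun i _ => ?_
      rw [Fin.val_succ]
      ring

theorem listVal_register {n : ℕ} (s : Bits (n + 1)) :
    listVal s (register n) = basisEquiv n (Fin.init s) := by
  rw [register, listVal_ofFn, basisEquiv_val, ← Equiv.sum_comp Fin.revPerm]
  refine Finset.sum_congr rfl fun i _ => ?_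
  rw [Fin.revPerm_apply, Fin.rev_rev, Fin.val_rev, show n - ((i : ℕ) + 1) = n - 1 - i by omega]
  rfl

/-- The increment of a bit string. -/
def bitIncrement {n : ℕ} (y : Bits n) : Bits n :=
  Fin.init (α := fun _ => Fin 2) (ripple 1 (register n) (Fin.snoc (α := fun _ => Fin 2) y 0))

theorem ripple_register {n : ℕ} (y : Bits n) :
    ripple 1 (register n) (Fin.snoc (α := fun _ => Fin 2) y 0) =
      Fin.snoc (α := fun _ => Fin 2) (bitIncrement y) 0 := by
  conv_lhs => rw [← Fin.snoc_init_self (ripple 1 (register n) _)]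
  rw [ripple_of_notMem (last_notMem_register n), Fin.snoc_last]
  rfl

theorem basisEquiv_bitIncrement {n : ℕ} (y : Bits n) :
    (basisEquiv n (bitIncrement y) : ℕ) = ((basisEquiv n y : ℕ) + 1) % 2 ^ n := by
  rw [bitIncrement, ← listVal_register, listVal_ripple (register_nodup n), listVal_register,
    length_register, Fin.init_snoc]
  rfl

theorem increment_apply_basisEquiv {n : ℕ} (x y : Bits n) :
    increment n (basisEquiv n x) (basisEquiv n y) = if x = bitIncrement y then 1 else 0 := by
  simp only [increment, ← basisEquiv_bitIncrement, ← Fin.ext_iff, (basisEquiv n).injective.eq_iff]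

/-- Negating before and after an increment gives a decrement. -/
theorem eq_bitIncrement_iff {n : ℕ} (x y : Bits n) :
    y = bitIncrement x ↔ x = negate (bitIncrement (negate y)) := by
  rw [← (basisEquiv n).injective.eq_iff, ← (basisEquiv n).injective.eq_iff, Fin.ext_iff,
    Fin.ext_iff, basisEquiv_bitIncrement]
  have h1 := basisEquiv_negate y
  have h2 := basisEquiv_negate (bitIncrement (negate y))
  rw [basisEquiv_bitIncrement] at h2
  have hx := (basisEquiv n x).isLt
  have hy := (basisEquiv n y).isLt
  generalize (basisEquiv n x : ℕ) = a, (basisEquiv n y : ℕ) = b,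
    (basisEquiv n (negate y) : ℕ) = c,
    (basisEquiv n (negate (bitIncrement (negate y))) : ℕ) = d at *
  generalize 2 ^ n = N at *
  have hmod : ∀ c < N, (c + 1) % N = if c + 1 = N then 0 else c + 1 := by
    intro c hc
    split_ifs with h
    · rw [h, Nat.mod_self]
    · exact Nat.mod_eq_of_lt (by omega)
  rw [hmod c (by omega)] at h2
  rw [hmod a hx]
  split_ifs at * <;> omega

theorem conjTranspose_increment_apply_basisEquiv {n : ℕ} (x y : Bits n) :
    (increment n)ᴴ (basisEquiv n x) (basisEquiv n y) =
      if x = negate (bitIncrement (negate y)) then 1 else 0 := by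
  rw [Matrix.conjTranspose_apply, increment_apply_basisEquiv]
  simp only [eq_bitIncrement_iff]
  split_ifs <;> simp

theorem Circuit.classicalCount_append {k : ℕ} (C D : Circuit k) :
    Circuit.classicalCount (C ++ D) = C.classicalCount + D.classicalCount := List.countP_append

theorem Circuit.hadamardCount_append {k : ℕ} (C D : Circuit k) :
    Circuit.hadamardCount (C ++ D) = C.hadamardCount + D.hadamardCount := List.countP_append

theorem ClassicalCost.exists_implements {n c : ℕ} {f : Bits (n + 1) → Bits (n + 1)}
    (hf : ClassicalCost f c) {F : Bits n → Bits n}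
    (hF : ∀ y : Bits n, f (Fin.snoc (α := fun _ => Fin 2) y 0) =
      Fin.snoc (α := fun _ => Fin 2) (F y) 0)
    {R : Matrix (Fin (2 ^ n)) (Fin (2 ^ n)) ℂ}
    (hR : ∀ x y, R (basisEquiv n x) (basisEquiv n y) = if x = F y then 1 else 0) :
    ∃ C : Circuit (n + 1), C.Implements R ∧ C.hadamardCount ≤ 2 ∧ C.classicalCount ≤ c := by
  obtain ⟨C, h1, h2, h3⟩ := hf
  refine ⟨C, fun x y a => ?_, by omega, h2⟩
  simp only [h3, basisMap, hF, hR, Fin.snoc_inj, and_comm (a := x = F y), ite_and]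

/-- Negation of all qubits but the ancilla. -/
def negateRegister {n : ℕ} (s : Bits (n + 1)) : Bits (n + 1) :=
  fun w => if w ∈ Finset.univ.erase (Fin.last n) then s w + 1 else s w

theorem negateRegister_cost (n : ℕ) : ClassicalCost (negateRegister (n := n)) n := by
  have h := ClassicalCost.xorOn (φ := fun _ => 1) (Finset.univ.erase (Fin.last n))
    (fun _ _ _ => rfl) fun t _ => ClassicalCost.not t
  exact h.mono (by simp)

theorem negateRegister_snoc {n : ℕ} (y : Bits n) (b : Fin 2) :
    negateRegister (Fin.snoc (α := fun _ => Fin 2) y b) =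
      Fin.snoc (α := fun _ => Fin 2) (negate y) b := by
  funext w
  refine Fin.lastCases ?_ (fun i => ?_) w
  · simp [negateRegister]
  · simp [negateRegister, negate, Fin.castSucc_ne_last]

theorem mul_onQubit_apply {k : ℕ} (A : Matrix (Bits k) (Bits k) ℂ) (t : Fin k)
    (U : Matrix (Fin 2) (Fin 2) ℂ) (x y : Bits k) :
    (A * onQubit t U) x y = ∑ b : Fin 2, A x (Function.update y t b) * U b (y t) := by
  rw [Matrix.mul_apply, ← Finset.sum_subset
    (Finset.subset_univ (Finset.univ.image (Function.update y t)))]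
  · rw [Finset.sum_image (Function.update_injective y t).injOn]
    refine Finset.sum_congr rfl fun b _ => ?_
    rw [onQubit, if_pos fun j hj => Function.update_of_ne hj _ _, Function.update_self]
  · intro z _ hz
    rw [onQubit, if_neg, mul_zero]
    intro h
    refine hz (Finset.mem_image.mpr ⟨z t, Finset.mem_univ _, ?_⟩)
    funext j
    by_cases hj : j = t
    · rw [hj, Function.update_self]
    · rw [Function.update_of_ne hj, h j hj]

theorem onQubit_mul_apply {k : ℕ} (A : Matrix (Bits k) (Bits k) ℂ) (t : Fin k)
    (U : Matrix (Fin 2) (Fin 2) ℂ) (x y : Bits k) :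
    (onQubit t U * A) x y = ∑ b : Fin 2, U (x t) b * A (Function.update x t b) y := by
  rw [Matrix.mul_apply, ← Finset.sum_subset
    (Finset.subset_univ (Finset.univ.image (Function.update x t)))]
  · rw [Finset.sum_image (Function.update_injective x t).injOn]
    refine Finset.sum_congr rfl fun b _ => ?_
    rw [onQubit, if_pos fun j hj => (Function.update_of_ne hj _ _).symm, Function.update_self]
  · intro z _ hz
    rw [onQubit, if_neg, zero_mul]
    intro h
    refine hz (Finset.mem_image.mpr ⟨z t, Finset.mem_univ _, ?_⟩)
    funext j
    by_cases hj : j = t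
    · rw [hj, Function.update_self]
    · rw [Function.update_of_ne hj, h j hj]

/-- Phase kickback: an ancilla in the state `HX|0⟩` turns the addition of a bit `χ` into the
sign `(-1) ^ χ`. -/
theorem ClassicalCost.exists_implements_phase {n c : ℕ} {f : Bits (n + 1) → Bits (n + 1)}
    (hf : ClassicalCost f c) {F : Bits n → Bits n} {χ : Bits n → Fin 2}
    (hF : ∀ (y : Bits n) (b : Fin 2), f (Fin.snoc (α := fun _ => Fin 2) y b) =
      Fin.snoc (α := fun _ => Fin 2) (F y) (b + χ y))
    {R : Matrix (Fin (2 ^ n)) (Fin (2 ^ n)) ℂ}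
    (hR : ∀ x y, R (basisEquiv n x) (basisEquiv n y) =
      if x = F y then (if χ y = 1 then -1 else 1) else 0) :
    ∃ C : Circuit (n + 1), C.Implements R ∧ C.hadamardCount ≤ 2 ∧ C.classicalCount ≤ c + 2 := by
  obtain ⟨C, h1, h2, h3⟩ := hf
  set l := Fin.last n
  refine ⟨[Gate.X l, Gate.H l] ++ (C ++ [Gate.H l, Gate.X l]), fun x y a => ?_, ?_, ?_⟩
  · have h2 : (1 / √2 : ℂ) * (1 / √2) = 1 / 2 := by
      rw [div_mul_div_comm, ← Complex.ofReal_mul, Real.mul_self_sqrt (by norm_num)]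
      norm_num
    have hmat : Circuit.matrix ([Gate.X l, Gate.H l] ++ (C ++ [Gate.H l, Gate.X l])) =
        onQubit l pauliX * (onQubit l hadamard *
          (basisMap f * onQubit l hadamard * onQubit l pauliX)) := by
      simp only [Circuit.matrix_append, Circuit.matrix, h3, Gate.matrix, one_mul,
        Matrix.mul_assoc]
    rw [hmat, hR]
    simp only [onQubit_mul_apply, mul_onQubit_apply, l, Fin.update_snoc_last, Fin.snoc_last,
      basisMap, hF, Fin.snoc_inj, Fin.sum_univ_two]
    by_cases hx : x = F y
    · rcases bit_cases a with rfl | rfl <;> rcases bit_cases (χ y) with h | h <;>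
        simp [hx, h, pauliX, hadamard] <;>
        first | linear_combination 2 * h2 | linear_combination -2 * h2
    · simp [hx]
  · rw [Circuit.hadamardCount_append, Circuit.hadamardCount_append, h1]
    rfl
  · rw [Circuit.classicalCount_append, Circuit.classicalCount_append]
    change 1 + (C.classicalCount + 1) ≤ c + 2
    omega

/-- Adds the indicator of the two constant bit strings into the ancilla: adding the negated
first qubit into the others turns them into ones exactly for these strings. -/
theorem exists_add_isConstant (m : ℕ) :
    ∃ f : Bits (m + 1 + 1) → Bits (m + 1 + 1), ClassicalCost f (12 * m + 12) ∧
      ∀ (y : Bits (m + 1)) (b : Fin 2), f (Fin.snoc (α := fun _ => Fin 2) y b) =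
        Fin.snoc (α := fun _ => Fin 2) y (b + if ∀ i, y i = y 0 then 1 else 0) := by
  set q : Fin (m + 1 + 1) := (0 : Fin (m + 1)).castSucc with hq
  set l := Fin.last (m + 1) with hl
  have hql : q ≠ l := Fin.castSucc_ne_last _
  set T := (Finset.univ.erase l).erase q with hT
  have hqT : q ∉ T := by simp [hT]
  have hlT : l ∉ T := by simp [hT]
  have hTcard : T.card = m := by
    rw [hT, Finset.card_erase_of_mem (by simp [hql]), Finset.card_erase_of_mem (Finset.mem_univ _)]
    simp
  have hE := ClassicalCost.xorOn (φ := fun s => s q + 1) (r := 2) T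
    (fun s s' h => by rw [h q hqT]) fun t ht => by
      have htq : q ≠ t := (ne_of_mem_of_not_mem ht hqT).symm
      refine cast ?_ ((ClassicalCost.not t).comp (ClassicalCost.cnot htq))
      congr 1
      funext s
      have assoc : ∀ a b c : Fin 2, a + b + c = a + (b + c) := by decide
      simp [xorInto, assoc]
  have hM := ClassicalCost.xorInto_conj hqT hlT hql
  rw [hTcard] at hE hM
  refine ⟨_, (hE.comp (hM.comp hE)).mono (by omega), fun y b => ?_⟩
  have hconj : (∀ w ∈ T, (if w ∈ T then (Fin.snoc (α := fun _ => Fin 2) y b : Bits _) w +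
      ((Fin.snoc (α := fun _ => Fin 2) y b : Bits _) q + 1)
      else (Fin.snoc (α := fun _ => Fin 2) y b : Bits _) w) = 1) ↔ ∀ i, y i = y 0 := by
    have key : ∀ a b : Fin 2, a + (b + 1) = 1 ↔ a = b := by decide
    constructor
    · intro h i
      by_cases hi : i = 0
      · rw [hi]
      · have hiT : i.castSucc ∈ T := by simp [hT, hl, hq, Fin.castSucc_ne_last, hi]
        have := h _ hiT
        rwa [if_pos hiT, key, hq, Fin.snoc_castSucc, Fin.snoc_castSucc] at this
    · intro h w hw
      rw [if_pos hw, key]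
      induction w using Fin.lastCases with
      | last => exact absurd hw hlT
      | cast i => rw [hq, Fin.snoc_castSucc, Fin.snoc_castSucc, h i]
  funext w
  simp only [Function.comp_apply, xorInto_of_ne hql, if_neg hqT]
  induction w using Fin.lastCases with
  | last => rw [if_neg hlT, xorInto_self, if_neg hlT, conj, Fin.snoc_last, Fin.snoc_last]
            simp only [hconj]
  | cast i =>
    have hil : i.castSucc ≠ l := Fin.castSucc_ne_last _
    have key : ∀ a b : Fin 2, a + (b + 1) + (b + 1) = a := by decide
    rw [xorInto_of_ne hil, Fin.snoc_castSucc, Fin.snoc_castSucc]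
    by_cases hi : i.castSucc ∈ T <;> simp [hi, key]

theorem exists_circuit {n : ℕ} (hn : 1 ≤ n) (l : Fin 5) :
    ∃ C : Circuit (n + 1), C.Implements (term n l) ∧ C.hadamardCount ≤ 2 ∧
      C.classicalCount ≤ 48 * n := by
  obtain ⟨m, rfl⟩ : ∃ m, n = m + 1 := ⟨n - 1, by omega⟩
  obtain ⟨g, hg, hg'⟩ := ClassicalCost.exists_increment _ _ (register_nodup (m + 1))
    (last_notMem_register (m + 1))
  rw [length_register] at hg
  have hinc : ∀ y : Bits (m + 1), g (Fin.snoc (α := fun _ => Fin 2) y 0) =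
      Fin.snoc (α := fun _ => Fin 2) (bitIncrement y) 0 := fun y => by
    rw [hg' _ (Fin.snoc_last _ _), ripple_register]
  have hN := negateRegister_cost (m + 1)
  fin_cases l
  · exact (ClassicalCost.id.mono (Nat.zero_le _)).exists_implements (F := id) (fun _ => rfl)
      fun x y => by simp [term, Matrix.one_apply]
  · exact (hg.mono (by omega)).exists_implements hinc increment_apply_basisEquiv
  · refine ((hN.comp (hg.comp hN)).mono (by omega)).exists_implements (fun y => ?_)
      conjTranspose_increment_apply_basisEquiv
    simp only [Function.comp_apply, negateRegister_snoc, hinc]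
  · refine (hN.mono (by omega)).exists_implements (fun y => negateRegister_snoc y 0) fun x y => ?_
    change tensorPow pauliX _ _ _ = _
    rw [tensorPow_pauliX, reindex_apply_basisEquiv]
    rfl
  · obtain ⟨f, hf, hf'⟩ := exists_add_isConstant m
    obtain ⟨C, h1, h2, h3⟩ := (hN.comp hf).exists_implements_phase (F := negate)
      (χ := fun y => if ∀ i, y i = y 0 then 1 else 0) (R := -cMinus (m + 1))
      (fun y b => by rw [Function.comp_apply, hf', negateRegister_snoc]) fun x y => by
        rw [neg_cMinus_eq, reindex_apply_basisEquiv]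
        simp [signedMap]
    exact ⟨C, h1, h2, h3.trans (by omega)⟩

end DirichletLCU

theorem theorem1 :
    -- the decomposition into five unitaries with coefficients in `{1, -2, 1/2, -1/2}`
    (∀ n : ℕ, 1 ≤ n →
      DirichletLCU.normalizedLaplacian n =
        ∑ l : Fin 5, DirichletLCU.coeff l • DirichletLCU.term n l) ∧
    (∀ l : Fin 5, DirichletLCU.coeff l ∈ ({1, -2, 1 / 2, -(1 / 2)} : Set ℂ)) ∧
    (∀ n : ℕ, 1 ≤ n → ∀ l : Fin 5,
      DirichletLCU.term n l ∈ Matrix.unitaryGroup (Fin (2 ^ n)) ℂ) ∧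
    -- the same decomposition written out
    (∀ n : ℕ, 1 ≤ n →
      DirichletLCU.normalizedLaplacian n =
        (-2 : ℂ) • (1 : Matrix (Fin (2 ^ n)) (Fin (2 ^ n)) ℂ)
          + DirichletLCU.increment n + (DirichletLCU.increment n)ᴴ
          - (1 / 2 : ℂ) • DirichletLCU.tensorPow DirichletLCU.pauliX n
          - (1 / 2 : ℂ) • DirichletLCU.cMinus n) ∧
    -- the last unitary as a product of gates, for `n = m + 1` qubits
    (∀ m : ℕ,
      -DirichletLCU.cMinus (m + 1) =
        DirichletLCU.tensor DirichletLCU.pauliX 1 * DirichletLCU.fanout m *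
          DirichletLCU.tensor DirichletLCU.pauliX 1 *
          DirichletLCU.tensor 1 (DirichletLCU.controlledZ m) *
          DirichletLCU.fanout m * DirichletLCU.tensor DirichletLCU.pauliX 1) ∧
    -- the gate count, with one ancilla qubit
    (∃ K : ℕ, ∀ n : ℕ, 1 ≤ n → ∀ l : Fin 5,
      ∃ C : DirichletLCU.Circuit (n + 1),
        DirichletLCU.Circuit.Implements C (DirichletLCU.term n l) ∧
        DirichletLCU.Circuit.hadamardCount C ≤ 2 ∧
        DirichletLCU.Circuit.classicalCount C ≤ K * n) := by
  exact ⟨fun n hn => (DirichletLCU.normalizedLaplacian_eq hn).trans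
      (DirichletLCU.sum_coeff_smul_term n).symm,
    DirichletLCU.coeff_mem, fun _ hn => DirichletLCU.term_mem_unitaryGroup hn,
    fun _ hn => DirichletLCU.normalizedLaplacian_eq hn, DirichletLCU.neg_cMinus_factorization,
    48, fun _ hn => DirichletLCU.exists_circuit hn⟩
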